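/- **Theorem (existence of Nash equilibria in quantum games).** Let $N$ be a number of players and let $H_j=\mathbb C^{d_j}$, $j=1,\dots,N$, be finite-dimensional Hilbert spaces. Let $\rho$ be a state on $H=H_1\otimes\cdots\otimes H_N$ (a positive semidefinite operator of trace $1$), let $\{M_\omega\}_{\omega\in\Omega}$ be a POVM on $H$ with a finite or countable outcome set $\Omega$ (positive semidefinite operators with $\sum_{\omega\in\Omega} M_\omega=\mathbf 1$), and let $f_j:\Omega\to\mathbb R$, $j=1,\dots,N$, be payoff functions. Let the strategy space of player $j$ be the full set $S_j$ of all trace-preserving completely positive linear maps on the space of linear operators on $H_j$. For a strategy profile $s=(s_1,\dots,s_N)\in S_1\times\cdots\times S_N$ the payoff of player $j$ is $$\Pi_j(s_1,\dots,s_N)=\sum_{\omega\in\Omega} f_j(\omega)\,\mathrm{tr}\big[M_\omega\,(s_1\otimes\cdots\otimes s_N)\rho\big],$$ where, if $\Omega$ is infinite, it is assumed that these series converge absolutely for every player and every strategy profile (for finite $\Omega$, or for bounded $f_j$, this is automatic). Then the game has at least one Nash equilibrium: there is a profile $s^*=(s_1^*,\dots,s_N^*)\in S_1\times\cdots\times S_N$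 such that $$\Pi_j(s_1^*,\dots,s_{j-1}^*,t,s_{j+1}^*,\dots,s_N^*)\le \Pi_j(s_1^*,\dots,s_N^*)\qquad\text{for all } j=1,\dots,N \text{ and all } t\in S_j .$$ -/

import Mathlib

namespace QuantumNash

universe u v

/-! ### Static games and Nash equilibria -/

/-- A static (simultaneous) game of `N` players: strategy spaces and real payoff functions on
strategy profiles. -/
structure StaticGame (N : ℕ) where
  Strategy : Fin N → Type u
  payoff : Fin N → (∀ j, Strategy j) → ℝ

/-- A profile is a Nash equilibrium if no player can gain by a unilateral deviation. -/
def StaticGame.IsNashEquilibrium {N : ℕ} (G : StaticGame.{u} N) (s : ∀ j, G.Strategy j) : Prop :=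
  ∀ (j : Fin N) (t : G.Strategy j), G.payoff j (Function.update s j t) ≤ G.payoff j s

/-! ### Operators and channels on `ℂⁿ` -/

/-- Linear operators on the Hilbert space `ℂⁿ`, as matrices in the standard orthonormal basis. -/
abbrev Op (n : ℕ) : Type := Matrix (Fin n) (Fin n) ℂ

section Channel

open scoped MatrixOrder Matrix.Norms.L2Operator CStarAlgebra

/-- Trace-preserving completely positive maps on the operators of `ℂⁿ`. The order on matrices is
the Loewner order, and complete positivity is Mathlib's `CompletelyPositiveMap`: for every `k`,
applying the map entrywise to a positive `k × k` matrix of operators gives a positive matrix. -/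
def Channel (n : ℕ) : Type :=
  {Φ : Op n →CP Op n // ∀ X : Op n, (Φ X).trace = X.trace}

/-- The underlying linear map of a channel. -/
def Channel.toLin {n : ℕ} (Φ : Channel n) : Op n →ₗ[ℂ] Op n := Φ.1.toLinearMap

end Channel

/-! ### Tensor products

The Hilbert space `ℂ^{d₁} ⊗ ⋯ ⊗ ℂ^{d_N}` has the orthonormal basis `e_{a₁} ⊗ ⋯ ⊗ e_{a_N}`, indexed
by tuples `a : ∀ j, Fin (d j)`. -/

/-- Linear operators on `ℂ^{d₁} ⊗ ⋯ ⊗ ℂ^{d_N}`, as matrices in the product basis. -/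
abbrev TOp {N : ℕ} (d : Fin N → ℕ) : Type :=
  Matrix (∀ j, Fin (d j)) (∀ j, Fin (d j)) ℂ

/-- The tensor product `A₁ ⊗ ⋯ ⊗ A_N` of operators. -/
def tensorOp {N : ℕ} {d : Fin N → ℕ} (A : ∀ j, Op (d j)) : TOp d :=
  Matrix.of fun a b => ∏ j, A j (a j) (b j)

/-- The tensor product `T₁ ⊗ ⋯ ⊗ T_N` of linear maps on operators: a matrix unit
`|a⟩⟨b| = ⊗ⱼ |aⱼ⟩⟨bⱼ|` is sent to `⊗ⱼ Tⱼ(|aⱼ⟩⟨bⱼ|)`. It is the unique linear map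
with `(⊗ⱼ Tⱼ)(⊗ⱼ Aⱼ) = ⊗ⱼ Tⱼ(Aⱼ)`, by `tensorMap_tensorOp` and `eq_tensorMap` below. -/
def tensorMap {N : ℕ} {d : Fin N → ℕ} (T : ∀ j, Op (d j) →ₗ[ℂ] Op (d j)) :
    TOp d →ₗ[ℂ] TOp d where
  toFun X := ∑ a, ∑ b, X a b • tensorOp fun j => T j (Matrix.single (a j) (b j) 1)
  map_add' X Y := by simp [add_smul, Finset.sum_add_distrib]
  map_smul' c X := by simp [mul_smul, Finset.smul_sum]

theorem tensorMap_apply {N : ℕ} {d : Fin N → ℕ} (T : ∀ j, Op (d j) →ₗ[ℂ] Op (d j)) (X : TOp d) :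
    tensorMap T X = ∑ a, ∑ b, X a b • tensorOp fun j => T j (Matrix.single (a j) (b j) 1) := rfl

theorem tensorMap_tensorOp {N : ℕ} {d : Fin N → ℕ} (T : ∀ j, Op (d j) →ₗ[ℂ] Op (d j))
    (A : ∀ j, Op (d j)) : tensorMap T (tensorOp A) = tensorOp fun j => T j (A j) := by
  have key : ∀ j, T j (A j) = ∑ p : Fin (d j) × Fin (d j),
      A j p.1 p.2 • T j (Matrix.single p.1 p.2 1) := by
    intro j
    conv_lhs => rw [Matrix.matrix_eq_sum_single (A j)]
    rw [Fintype.sum_prod_type]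
    simp only [map_sum]
    refine Finset.sum_congr rfl fun x _ => Finset.sum_congr rfl fun y _ => ?_
    rw [← map_smul, Matrix.smul_single, smul_eq_mul, mul_one]
  ext c e
  simp only [tensorMap_apply, Matrix.sum_apply, Matrix.smul_apply, tensorOp, Matrix.of_apply, key,
    smul_eq_mul]
  rw [Finset.prod_univ_sum, Fintype.piFinset_univ, ← Fintype.sum_prod_type']
  simp only [← Finset.prod_mul_distrib]
  refine Fintype.sum_equiv ⟨fun p j => (p.1 j, p.2 j), fun q => (fun j => (q j).1,
    fun j => (q j).2), fun _ => rfl, fun _ => rfl⟩ _ _ fun p => rfl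

theorem eq_tensorMap {N : ℕ} {d : Fin N → ℕ} (T : ∀ j, Op (d j) →ₗ[ℂ] Op (d j))
    (S : TOp d →ₗ[ℂ] TOp d) (hS : ∀ A : ∀ j, Op (d j), S (tensorOp A) = tensorOp fun j => T j (A j)) :
    S = tensorMap T := by
  have hunit : ∀ a b : ∀ j, Fin (d j),
      (Matrix.single a b 1 : TOp d) = tensorOp fun j => Matrix.single (a j) (b j) (1 : ℂ) := by
    intro a b
    ext c e
    simp only [tensorOp, Matrix.of_apply, Matrix.single_apply, Finset.prod_ite_zero,
      Finset.prod_const_one, funext_iff, Finset.mem_univ, true_imp_iff, forall_and]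
  refine LinearMap.ext fun X => ?_
  rw [Matrix.matrix_eq_sum_single X]
  simp only [map_sum]
  refine Finset.sum_congr rfl fun a _ => Finset.sum_congr rfl fun b _ => ?_
  have : (Matrix.single a b (X a b) : TOp d) = X a b • Matrix.single a b 1 := by
    rw [Matrix.smul_single, smul_eq_mul, mul_one]
  rw [this, map_smul, map_smul, hunit, hS, tensorMap_tensorOp]

/-! ### Quantum games -/

section Game

open scoped ComplexOrder

/-- A static quantum game of `N` players with Hilbert spaces `H_j = ℂ^{d j}`, with finite or
countable outcome set `Ω`. -/
structure QuantumGame {N : ℕ} (d : Fin N → ℕ) (Ω : Type v) [Countable Ω] where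
  /-- the initial state, a density matrix on `H₁ ⊗ ⋯ ⊗ H_N` -/
  state : TOp d
  state_pos : state.PosSemidef
  state_trace : state.trace = 1
  /-- the POVM on `H₁ ⊗ ⋯ ⊗ H_N` -/
  povm : Ω → TOp d
  povm_pos : ∀ ω, (povm ω).PosSemidef
  povm_sum : HasSum povm 1
  /-- `outcomePayoff j ω` is the payoff of player `j` for the outcome `ω` -/
  outcomePayoff : Fin N → Ω → ℝ

end Game

namespace QuantumGame

variable {N : ℕ} {d : Fin N → ℕ} {Ω : Type v} [Countable Ω]

/-- The final state `(s₁ ⊗ ⋯ ⊗ s_N) ρ`. -/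
noncomputable def finalState (G : QuantumGame d Ω) (s : ∀ j, Channel (d j)) : TOp d :=
  tensorMap (fun j => (s j).toLin) G.state

/-- The probability `tr (M_ω (s₁ ⊗ ⋯ ⊗ s_N) ρ)` of the outcome `ω`. The trace is a non-negative
real number, as a trace of a product of two positive operators. -/
noncomputable def prob (G : QuantumGame d Ω) (s : ∀ j, Channel (d j)) (ω : Ω) : ℝ :=
  (G.povm ω * G.finalState s).trace.re

/-- The expected payoffs exist: for every player and every strategy profile the series defining the
expected payoff converges absolutely. -/
def PayoffsConverge (G : QuantumGame d Ω) : Prop :=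
  ∀ (j : Fin N) (s : ∀ j, Channel (d j)), Summable fun ω => G.outcomePayoff j ω * G.prob s ω

/-- For finitely many outcomes the expected payoffs always exist. -/
theorem payoffsConverge_of_finite [Finite Ω] (G : QuantumGame d Ω) : G.PayoffsConverge :=
  fun _ _ => Summable.of_finite

/-- The static game given by a quantum game played with the full strategic spaces: player `j`
chooses an arbitrary trace-preserving completely positive map on the operators of `H_j`, and the
payoffs are `Π_j(s) = ∑_ω f_j(ω) tr (M_ω (s₁ ⊗ ⋯ ⊗ s_N) ρ)`. -/
noncomputable def fullGame (G : QuantumGame d Ω) : StaticGame.{0} N where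
  Strategy j := Channel (d j)
  payoff j s := ∑' ω, G.outcomePayoff j ω * G.prob s ω

end QuantumGame

end QuantumNash

/-!
# Existence of Nash equilibria in quantum games

The channels on `ℂⁿ`, described by their coefficients, form a compact convex set
(`isCompact_channelSet`, `convex_channelSet`): complete positivity and trace preservation are closed
convex conditions, and the trace bounds the values on positive operators, which span all operators.
The payoff of a player is a real linear functional of the final state
(`QuantumGame.exists_payoff_eq`), hence continuous by finite-dimensionality, and the final
state is continuous in the profile and affine in the strategy of each single player.

For profiles `x`, `y` let `Ψ x y` be the sum over all players `j` of the gain of `j` from deviating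
alone from `x j` to `y j`. This function is continuous in `x`, concave in `y`, and zero for `x = y`,
so Ky Fan's inequality (`exists_forall_le_zero`) gives a profile `x` with `Ψ x y ≤ 0` for all `y`.
If `y` differs from `x` in a single entry, this says that the deviation does not pay, so
`x` is an equilibrium.

By compactness, Ky Fan's inequality reduces to finitely many `y`, where it follows from Brouwer's
theorem for the standard simplex (`brouwer_stdSimplex`). Brouwer's theorem is deduced from Scarf's
combinatorial lemma (`IsSlackRanking.exists_colorful`), a Sperner-type parity argument that replaces
triangulations by rankings: applied to the grid points of the simplex, ranked by their
coordinates, with a point `p` coloured by some `i` such that `p i ≤ f p i`, it yields clusters of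
grid points with all relevant colours, and these accumulate at a fixed point of `f`.
-/

/-! ### Scarf's combinatorial lemma -/

section Scarf

variable {V I α : Type*} [LinearOrder α]

/-- A set `S` is dominant for the rankings `r i` of `V` if no point of `V` lies strictly above the
minimum of `S` in all rankings at once. -/
def Dominant (r : I → V → α) (S : Finset V) : Prop :=
  ∀ x, ∃ i, ∀ s ∈ S, r i x ≤ r i s

theorem Dominant.mono {r : I → V → α} {S T : Finset V} (hS : Dominant r S) (h : T ⊆ S) :
    Dominant r T := fun x => (hS x).imp fun _ hi s hs => hi s (h hs)

theorem exists_minima (r : I → V → α) {T : Finset V} (hT : T.Nonempty) :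
    ∃ m : I → V, ∀ i, m i ∈ T ∧ ∀ s ∈ T, r i (m i) ≤ r i s := by
  choose m hm using fun i => T.exists_min_image (r i) hT
  exact ⟨m, hm⟩

/-- Every element of a dominant set is its minimum in one of the rankings, so that a dominant set
has at most as many elements as there are rankings. -/
theorem Dominant.exists_minimum_eq {r : I → V → α} (hr : ∀ i, Function.Injective (r i))
    {T : Finset V} (hT : Dominant r T) {m : I → V}
    (hm : ∀ i, m i ∈ T ∧ ∀ s ∈ T, r i (m i) ≤ r i s) {x : V} (hx : x ∈ T) : ∃ i, m i = x := by
  obtain ⟨i, hi⟩ := hT x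
  exact ⟨i, hr i (le_antisymm ((hm i).2 x hx) (hi _ (hm i).1))⟩

/-- Let the dominant set `T` have one element less than there are rankings. Then two rankings
`i ≠ j` share their minimum on `T`, and the points `x` for which `T ∪ {x}` is dominant are
those that are, for `k = i` or `k = j`, the `k`-largest among the points exceeding the minimum of
`T` in all rankings but `k`. -/
theorem Dominant.exists_insert_iff [DecidableEq V] [Fintype I] [DecidableEq I]
    {r : I → V → α} (hr : ∀ i, Function.Injective (r i))
    {T : Finset V} (hT : Dominant r T) (hcard : T.card + 1 = Fintype.card I) {m : I → V}
    (hm : ∀ i, m i ∈ T ∧ ∀ s ∈ T, r i (m i) ≤ r i s) :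
    ∃ i j, i ≠ j ∧ m i = m j ∧ ∀ x, (x ∉ T ∧ Dominant r (insert x T)) ↔
      ∃ k, (k = i ∨ k = j) ∧ (∀ l ≠ k, r l (m l) < r l x) ∧
        ∀ y, (∀ l ≠ k, r l (m l) < r l y) → r k y ≤ r k x := by
  obtain ⟨i, -, j, -, hij, hmij⟩ := Finset.exists_ne_map_eq_of_card_lt_of_maps_to
    (s := Finset.univ) (t := T) (by rw [Finset.card_univ]; omega) (f := m)
    (fun i _ => (hm i).1)
  refine ⟨i, j, hij, hmij, fun x => ⟨?_, ?_⟩⟩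
  · rintro ⟨hxT, hd⟩
    obtain ⟨m', hm'⟩ := exists_minima r (Finset.insert_nonempty x T)
    -- `m'` is a bijection from the rankings onto `T ∪ {x}`, by counting.
    have hinj : Function.Injective m' := by
      have hsurj : Finset.univ.image m' = insert x T := by
        ext y
        simp only [Finset.mem_image, Finset.mem_univ, true_and]
        constructor
        · rintro ⟨l, rfl⟩
          exact (hm' l).1
        · exact fun hy => hd.exists_minimum_eq hr hm' hy
      have : (Finset.univ.image m').card = (Finset.univ : Finset I).card := by
        rw [hsurj, Finset.card_insert_of_notMem hxT, Finset.card_univ, hcard]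
      intro a b hab
      exact Finset.card_image_iff.1 this (by simp) (by simp) hab
    obtain ⟨k, hk⟩ := hd.exists_minimum_eq hr hm' (Finset.mem_insert_self x T)
    have hne : ∀ l ≠ k, m' l ∈ T := fun l hl =>
      (Finset.mem_insert.1 (hm' l).1).resolve_left fun h => hl (hinj (h.trans hk.symm))
    have hmm : ∀ l ≠ k, m' l = m l := fun l hl =>
      hr l (le_antisymm ((hm' l).2 _ (Finset.mem_insert_of_mem (hm l).1))
        ((hm l).2 _ (hne l hl)))
    refine ⟨k, ?_, fun l hl => ?_, fun y hy => ?_⟩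
    · by_contra! hcon
      exact hij (hinj ((hmm i hcon.1.symm).trans (hmij.trans (hmm j hcon.2.symm).symm)))
    · refine lt_of_le_of_ne ?_ fun h => hxT ?_
      · rw [← hmm l hl]
        exact (hm' l).2 x (Finset.mem_insert_self x T)
      · rw [← hr l h]
        exact (hm l).1
    · obtain ⟨l, hl⟩ := hd y
      obtain rfl : l = k := by
        by_contra hlk
        exact (hy l hlk).not_ge (hl _ (Finset.mem_insert_of_mem (hm l).1))
      exact hl x (Finset.mem_insert_self x T)
  · rintro ⟨k, hk, hx, hmax⟩
    constructor
    · intro hxT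
      obtain ⟨l, hl, hlx⟩ : ∃ l, l ≠ k ∧ m l = x := by
        obtain ⟨l, hl⟩ := hT.exists_minimum_eq hr hm hxT
        by_cases hlk : l = k
        · rcases hk with rfl | rfl
          · exact ⟨j, hij.symm, by rw [← hl, hlk, hmij]⟩
          · exact ⟨i, hij, by rw [← hl, hlk, hmij]⟩
        · exact ⟨l, hlk, hl⟩
      exact (hx l hl).ne (by rw [hlx])
    · have key : ∀ y, (∀ l ≠ k, r l (m l) < r l y) → ∀ s ∈ T, r k y ≤ r k s := by
        intro y hy
        obtain ⟨l, hl⟩ := hT y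
        obtain rfl : l = k := by
          by_contra hlk
          exact (hy l hlk).not_ge (hl _ (hm l).1)
        exact hl
      intro y
      by_cases hy : ∀ l ≠ k, r l (m l) < r l y
      · refine ⟨k, fun s hs => ?_⟩
        rcases Finset.mem_insert.1 hs with rfl | hs
        · exact hmax y hy
        · exact key y hy s hs
      · push Not at hy
        obtain ⟨l, hl, hly⟩ := hy
        refine ⟨l, fun s hs => ?_⟩
        rcases Finset.mem_insert.1 hs with rfl | hs
        · exact hly.trans (hx l hl).le
        · exact hly.trans ((hm l).2 s hs)

theorem exists_unique_max [Fintype V] {f : V → α} (hf : Function.Injective f)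
    {p : V → Prop} (hp : ∃ x, p x) : ∃ a, ∀ x, (p x ∧ ∀ y, p y → f y ≤ f x) ↔ x = a := by
  classical
  obtain ⟨x₀, hx₀⟩ := hp
  obtain ⟨a, ha, hmax⟩ := (Finset.univ.filter p).exists_max_image f ⟨x₀, by simpa using hx₀⟩
  simp only [Finset.mem_filter, Finset.mem_univ, true_and] at ha hmax
  refine ⟨a, fun x => ⟨fun h => hf (le_antisymm (hmax x h.1) (h.2 a ha)), ?_⟩⟩
  rintro rfl
  exact ⟨ha, hmax⟩

end Scarf

section Slack

variable {X I α : Type*} [Fintype X] [DecidableEq X] [Fintype I] [DecidableEq I] [LinearOrder α]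

/-- Rankings of a set `X` extended by one slack element for each ranking: the slack element of
`i` is the least in the ranking `i`, and lies above all of `X` in the other rankings. -/
structure IsSlackRanking (r : I → X ⊕ I → α) : Prop where
  injective : ∀ i, Function.Injective (r i)
  slack_le : ∀ i v, r i (Sum.inr i) ≤ r i v
  lt_slack : ∀ i j x, j ≠ i → r i (Sum.inl x) < r i (Sum.inr j)

/-- A dominant set with one element less than there are rankings, and not made of slack
elements only, is contained in exactly two dominant sets with one element more. -/
theorem IsSlackRanking.exists_two {r : I → X ⊕ I → α} (hr : IsSlackRanking r)
    {T : Finset (X ⊕ I)} (hT : Dominant r T) (hcard : T.card + 1 = Fintype.card I)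
    {x₀ : X} (hx₀ : Sum.inl x₀ ∈ T) :
    ∃ a b, a ≠ b ∧ ∀ x, (x ∉ T ∧ Dominant r (insert x T)) ↔ x = a ∨ x = b := by
  obtain ⟨m, hm⟩ := exists_minima r ⟨_, hx₀⟩
  obtain ⟨i, j, hij, hmij, h⟩ := hT.exists_insert_iff hr.injective hcard hm
  have hex : ∀ k, ∃ x, ∀ l ≠ k, r l (m l) < r l x := fun k => ⟨Sum.inr k, fun l hl =>
    ((hm l).2 _ hx₀).trans_lt (hr.lt_slack l k x₀ hl.symm)⟩
  obtain ⟨a, ha⟩ := exists_unique_max (hr.injective i) (hex i)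
  obtain ⟨b, hb⟩ := exists_unique_max (hr.injective j) (hex j)
  refine ⟨a, b, ?_, fun x => ?_⟩
  · rintro rfl
    have h1 := ((ha a).2 rfl).1
    have h2 := ((hb a).2 rfl).1
    obtain ⟨l, hl⟩ := hT a
    have := hl _ (hm l).1
    by_cases hli : l = i
    · exact (h2 l (hli ▸ hij)).not_ge this
    · exact (h1 l hli).not_ge this
  · rw [h, ← ha, ← hb]
    simp only [or_and_right, exists_or, exists_eq_left]

/-- The set of all slack elements but one is contained in exactly one dominant set with one
element more. -/
theorem IsSlackRanking.exists_one [Nontrivial I] [Nonempty X] {r : I → X ⊕ I → α}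
    (hr : IsSlackRanking r) (i₀ : I) {T : Finset (X ⊕ I)}
    (hT : T = (Finset.univ.erase i₀).image Sum.inr) :
    ∃ a, ∀ x, (x ∉ T ∧ Dominant r (insert x T)) ↔ x = a := by
  have hmem : ∀ i, Sum.inr i ∈ T ↔ i ≠ i₀ := by simp [hT]
  have hinl : ∀ x, Sum.inl x ∉ T := by simp [hT]
  obtain ⟨i₁, hi₁⟩ := exists_ne i₀
  have hcard : T.card + 1 = Fintype.card I := by
    rw [hT, Finset.card_image_of_injective _ Sum.inr_injective, Finset.card_erase_of_mem (by simp),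
      Finset.card_univ]
    have := Fintype.card_pos (α := I)
    omega
  have hdom : Dominant r T := by
    rintro (x | i)
    · refine ⟨i₀, fun s hs => ?_⟩
      rcases s with s | s
      · exact absurd hs (hinl s)
      · exact (hr.lt_slack _ _ _ ((hmem s).1 hs)).le
    · exact ⟨i, fun s _ => hr.slack_le i s⟩
  obtain ⟨m, hm⟩ := exists_minima r ⟨_, (hmem i₁).2 hi₁⟩
  have hmi : ∀ i ≠ i₀, m i = Sum.inr i := fun i hi =>
    hr.injective i (le_antisymm ((hm i).2 _ ((hmem i).2 hi)) (hr.slack_le i _))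
  obtain ⟨i, j, hij, hmij, h⟩ := hdom.exists_insert_iff hr.injective hcard hm
  -- One of the two rankings with a common minimum is the one whose slack element is missing.
  obtain ⟨k, hk, hmk, hk'⟩ : ∃ k, k ≠ i₀ ∧ m i₀ = m k ∧ ∀ p : I → Prop,
      (∃ l, (l = i ∨ l = j) ∧ p l) ↔ p i₀ ∨ p k := by
    by_cases hi : i = i₀
    · exact ⟨j, by rw [← hi]; exact hij.symm, by rw [← hi, hmij], fun p => by
        simp only [or_and_right, exists_or, exists_eq_left, hi]⟩
    · have hj : j = i₀ := by
        by_contra hj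
        rw [hmi i hi, hmi j hj] at hmij
        exact hij (Sum.inr_injective hmij)
      exact ⟨i, hi, by rw [← hj, hmij], fun p => by
        simp only [or_and_right, exists_or, exists_eq_left, hj, or_comm]⟩
  obtain ⟨x₀⟩ := ‹Nonempty X›
  obtain ⟨a, ha⟩ := exists_unique_max (hr.injective i₀)
    (p := fun x => ∀ l ≠ i₀, r l (m l) < r l x) ⟨Sum.inl x₀, fun l hl => by
      rw [hmi l hl]
      exact lt_of_le_of_ne (hr.slack_le l _) fun h => by simpa using hr.injective l h⟩
  refine ⟨a, fun x => ?_⟩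
  rw [h, hk', ← ha]
  refine or_iff_left ?_
  rintro ⟨hx, -⟩
  have h0 := hx i₀ hk.symm
  rw [hmk, hmi k hk] at h0
  rcases x with x | l
  · exact (hr.lt_slack i₀ k x hk).not_gt h0
  · by_cases hl : l = i₀
    · subst hl
      exact (hr.slack_le l _).not_gt h0
    · by_cases hlk : l = k
      · exact h0.ne (by rw [hlk])
      · exact (hx l hlk).ne (by rw [hmi l hl])

/-- **Scarf's lemma**. If the elements of `X ⊕ I` are coloured by `I`, each slack element with its
own colour, then some dominant set of `|I|` elements carries all colours. As in Sperner's
lemma this is a parity argument: the pairs `(S, x)` with `x ∈ S`, such that `S \ {x}`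
carries exactly the colours other than `i₀`, are counted by `S` and by `S \ {x}`. -/
theorem IsSlackRanking.exists_colorful [Nontrivial I] [Nonempty X] {r : I → X ⊕ I → α}
    (hr : IsSlackRanking r) (c : X ⊕ I → I) (hc : ∀ i, c (Sum.inr i) = i) :
    ∃ S : Finset (X ⊕ I), S.card = Fintype.card I ∧ Dominant r S ∧ S.image c = Finset.univ := by
  classical
  by_contra! hcon
  obtain ⟨i₀⟩ := (inferInstance : Nonempty I)
  have hcardI : (Finset.univ.erase i₀).card + 1 = Fintype.card I := by
    rw [Finset.card_erase_add_one (Finset.mem_univ i₀), Finset.card_univ]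
  let A : Finset (Finset (X ⊕ I) × (X ⊕ I)) := Finset.univ.filter fun p =>
    p.1.card = Fintype.card I ∧ Dominant r p.1 ∧ p.2 ∈ p.1 ∧
      (p.1.erase p.2).image c = Finset.univ.erase i₀
  have hA : ∀ S x, (S, x) ∈ A ↔ S.card = Fintype.card I ∧ Dominant r S ∧ x ∈ S ∧
      (S.erase x).image c = Finset.univ.erase i₀ := by simp [A]
  -- Counted by `S`, the pairs come in twos.
  have hEven : Even A.card := by
    rw [Finset.card_eq_sum_card_fiberwise (f := Prod.fst) (t := Finset.univ) (by simp)]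
    refine Finset.even_sum _ fun S _ => ?_
    rcases (A.filter fun p => p.1 = S).eq_empty_or_nonempty with h | ⟨⟨S', x⟩, h⟩
    · simp [h]
    obtain ⟨hxA, rfl⟩ : (S', x) ∈ A ∧ S' = S := by simpa using h
    obtain ⟨hS, hd, hx, him⟩ := (hA _ _).1 hxA
    have hcx : c x ≠ i₀ := by
      intro hcx
      refine hcon S' hS hd ?_
      rw [← Finset.insert_erase hx, Finset.image_insert, him, hcx, Finset.insert_erase (by simp)]
    obtain ⟨y, hy, hyx⟩ : ∃ y ∈ S'.erase x, c y = c x := by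
      rw [← Finset.mem_image, him]
      simpa using hcx
    obtain ⟨hyne, hyS⟩ := Finset.mem_erase.1 hy
    have hinj : ∀ z ∈ S', (S'.erase z).image c = Finset.univ.erase i₀ →
        Set.InjOn c (S'.erase z) := fun z hz h => Finset.card_image_iff.1 (by
      rw [h]
      have := Finset.card_erase_add_one hz
      omega)
    have hyA : (S', y) ∈ A := by
      refine (hA _ _).2 ⟨hS, hd, hyS, ?_⟩
      rw [← him, ← Finset.insert_erase (Finset.mem_erase.2 ⟨hyne.symm, hx⟩ : x ∈ S'.erase y),
        ← Finset.insert_erase hy, Finset.erase_right_comm, Finset.image_insert,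
        Finset.image_insert, hyx]
    have : A.filter (fun p => p.1 = S') = {(S', x), (S', y)} := by
      ext ⟨S, z⟩
      simp only [Finset.mem_filter, Finset.mem_insert, Finset.mem_singleton, Prod.mk.injEq]
      constructor
      · rintro ⟨hz, rfl⟩
        obtain ⟨-, -, hzS, hzim⟩ := (hA _ _).1 hz
        by_contra! hne
        refine hyne (hinj z hzS hzim ?_ ?_ hyx)
        · exact Finset.mem_coe.2 (Finset.mem_erase.2 ⟨fun h => hne.2 rfl h.symm, hyS⟩)
        · exact Finset.mem_coe.2 (Finset.mem_erase.2 ⟨fun h => hne.1 rfl h.symm, hx⟩)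
      · rintro (⟨rfl, rfl⟩ | ⟨rfl, rfl⟩)
        · exact ⟨hxA, rfl⟩
        · exact ⟨hyA, rfl⟩
    rw [this, Finset.card_pair (by simpa using hyne.symm)]
    exact even_two
  -- Counted by `T = S \ {x}`, they come in twos except for a single one.
  set T₀ : Finset (X ⊕ I) := (Finset.univ.erase i₀).image Sum.inr with hT₀
  have hfib : ∀ T : Finset (X ⊕ I), T.card + 1 = Fintype.card I →
      T.image c = Finset.univ.erase i₀ → ∀ p : Finset (X ⊕ I) × (X ⊕ I),
      (p ∈ A ∧ p.1.erase p.2 = T) ↔ p.1 = insert p.2 T ∧ (p.2 ∉ T ∧ Dominant r (insert p.2 T)) := by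
    rintro T hT hTc ⟨S, x⟩
    rw [hA]
    constructor
    · rintro ⟨⟨hS, hd, hx, him⟩, rfl⟩
      simp [Finset.insert_erase hx, hd]
    · rintro ⟨h, hx, hd⟩
      simp only at h hx hd
      subst h
      simp [Finset.card_insert_of_notMem hx, Finset.erase_insert hx, hT, hTc, hd]
  have hOdd : Odd A.card := by
    rw [Finset.card_eq_sum_card_fiberwise (f := fun p => p.1.erase p.2) (t := Finset.univ)
      (by simp), ← Finset.add_sum_erase _ _ (Finset.mem_univ T₀)]
    refine Odd.add_even ?_ (Finset.even_sum _ fun T hT => ?_)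
    · obtain ⟨a, ha⟩ := hr.exists_one i₀ hT₀
      have : A.filter (fun p => p.1.erase p.2 = T₀) = {(insert a T₀, a)} := by
        ext p
        rw [Finset.mem_filter, hfib T₀, ha, Finset.mem_singleton, Prod.ext_iff]
        · constructor
          · rintro ⟨h, rfl⟩
            exact ⟨h, rfl⟩
          · rintro ⟨h, h'⟩
            simp only at h h'
            exact ⟨by rw [h, h'], h'⟩
        · rw [hT₀, Finset.card_image_of_injective _ Sum.inr_injective, hcardI]
        · rw [hT₀, Finset.image_image]
          ext i
          simp [hc]
      rw [this, Finset.card_singleton]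
      exact odd_one
    · rcases (A.filter fun p => p.1.erase p.2 = T).eq_empty_or_nonempty with h | ⟨⟨S, x⟩, h⟩
      · simp [h]
      obtain ⟨hxA, rfl⟩ : (S, x) ∈ A ∧ S.erase x = T := by simpa using h
      obtain ⟨hS, hd, hx, him⟩ := (hA _ _).1 hxA
      have hcard : (S.erase x).card + 1 = Fintype.card I := by
        rw [Finset.card_erase_add_one hx, hS]
      obtain ⟨x₀, hx₀⟩ : ∃ x₀, Sum.inl x₀ ∈ S.erase x := by
        by_contra! hno
        refine Finset.ne_of_mem_erase hT (Finset.eq_of_subset_of_card_le ?_ ?_)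
        · rintro (y | i) hy
          · exact absurd hy (hno y)
          · refine Finset.mem_image_of_mem _ ?_
            rw [← him, ← hc i]
            exact Finset.mem_image_of_mem c (by simpa [hc] using hy)
        · rw [hT₀, Finset.card_image_of_injective _ Sum.inr_injective]
          omega
      obtain ⟨a, b, hab, hiff⟩ := hr.exists_two (hd.mono (Finset.erase_subset x S)) hcard hx₀
      have : A.filter (fun p => p.1.erase p.2 = S.erase x) =
          {(insert a (S.erase x), a), (insert b (S.erase x), b)} := by
        ext p
        rw [Finset.mem_filter, hfib _ hcard him, hiff, Finset.mem_insert, Finset.mem_singleton,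
          Prod.ext_iff, Prod.ext_iff]
        constructor
        · rintro ⟨h, rfl | rfl⟩
          · exact Or.inl ⟨h, rfl⟩
          · exact Or.inr ⟨h, rfl⟩
        · rintro (⟨h, h'⟩ | ⟨h, h'⟩) <;> simp only at h h'
          · exact ⟨by rw [h, h'], Or.inl h'⟩
          · exact ⟨by rw [h, h'], Or.inr h'⟩
      rw [this, Finset.card_pair (by simp [hab])]
      exact even_two
  exact (Nat.not_even_iff_odd.2 hOdd) hEven

end Slack

/-! ### Brouwer's fixed point theorem on the standard simplex -/

section Brouwer

/-- The points of the standard simplex with coordinates in `m⁻¹ ℕ`, scaled by `m`. -/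
abbrev GridPoint (I : Type*) [Fintype I] [DecidableEq I] (m : ℕ) : Type _ :=
  {x : I → ℕ // x ∈ Finset.piAntidiag Finset.univ m}

theorem GridPoint.sum_eq {I : Type*} [Fintype I] [DecidableEq I] {m : ℕ} (x : GridPoint I m) :
    ∑ i, x.1 i = m := (Finset.mem_piAntidiag.1 x.2).1

/-- The ranking of the grid points by their `i`-th coordinate, ties being broken by an enumeration
of the grid, and extended to slack elements. -/
noncomputable def gridRanking (I : Type*) [Fintype I] [DecidableEq I] (m : ℕ) (i : I) :
    GridPoint I m ⊕ I → ℤ ×ₗ ℕ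
  | Sum.inl x => toLex ((x.1 i : ℤ), (Fintype.equivFin (GridPoint I m) x : ℕ))
  | Sum.inr j => toLex (if j = i then -1 else (m : ℤ) + 1, (Fintype.equivFin I j : ℕ))

theorem isSlackRanking_gridRanking (I : Type*) [Fintype I] [DecidableEq I] (m : ℕ) :
    IsSlackRanking (gridRanking I m) where
  injective i := by
    have hle : ∀ x : GridPoint I m, x.1 i ≤ m := fun x => by
      conv_rhs => rw [← x.sum_eq]
      exact Finset.single_le_sum (f := x.1) (fun _ _ => Nat.zero_le _) (Finset.mem_univ i)
    rintro (x | j) (y | k) h <;>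
      simp only [gridRanking, EmbeddingLike.apply_eq_iff_eq, Prod.mk.injEq] at h
    · rw [(Fintype.equivFin _).injective (Fin.ext h.2)]
    · have := hle x
      have := h.1
      split_ifs at this; omega
    · have := hle y
      have := h.1
      split_ifs at this; omega
    · rw [(Fintype.equivFin _).injective (Fin.ext h.2)]
  slack_le i v := by
    rcases v with x | j
    · refine (Prod.Lex.toLex_lt_toLex.2 (Or.inl ?_)).le
      simp only [if_true]
      omega
    · by_cases hj : j = i
      · rw [hj]
      · refine (Prod.Lex.toLex_lt_toLex.2 (Or.inl ?_)).le
        simp only [if_true, if_neg hj]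
        omega
  lt_slack i j x hj := by
    refine Prod.Lex.toLex_lt_toLex.2 (Or.inl ?_)
    have hle : x.1 i ≤ m := by
      conv_rhs => rw [← x.sum_eq]
      exact Finset.single_le_sum (f := x.1) (fun _ _ => Nat.zero_le _) (Finset.mem_univ i)
    simp only [if_neg hj]
    omega

/-- A grid point exists above any prescription of coordinates with sum at most `m`. -/
theorem GridPoint.exists_ge {I : Type*} [Fintype I] [DecidableEq I] [Nonempty I] {m : ℕ}
    (b : I → ℕ) (hb : ∑ i, b i ≤ m) : ∃ x : GridPoint I m, ∀ i, b i ≤ x.1 i := by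
  obtain ⟨i₀⟩ := ‹Nonempty I›
  refine ⟨⟨b + Pi.single i₀ (m - ∑ i, b i), ?_⟩, fun i => by simp⟩
  rw [Finset.mem_piAntidiag]
  refine ⟨?_, by simp⟩
  simp only [Pi.add_apply, Finset.sum_add_distrib, Finset.sum_pi_single', Finset.mem_univ, if_true]
  omega

/-- For every colouring of the grid there is a grid point `q` such that each colour `i` occurs at a
grid point near `q`, unless `q i` is close to `0`. -/
theorem exists_gridPoint_of_coloring {I : Type*} [Fintype I] [DecidableEq I] [Nontrivial I] (m : ℕ)
    (c : GridPoint I m → I) :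
    ∃ q : GridPoint I m, ∀ i, q.1 i ≤ Fintype.card I ∨ ∃ s : GridPoint I m, c s = i ∧
      ∀ l, q.1 l ≤ s.1 l + Fintype.card I ∧ s.1 l ≤ q.1 l + Fintype.card I := by
  have : Nonempty (GridPoint I m) :=
    ⟨(GridPoint.exists_ge (m := m) (fun _ : I => 0) (by simp)).choose⟩
  obtain ⟨S, -, hd, hc⟩ := (isSlackRanking_gridRanking I m).exists_colorful (Sum.elim c id)
    fun _ => rfl
  -- The rankings whose slack element is not in `S`.
  set C : Finset I := Finset.univ.filter fun i => Sum.inr i ∉ S with hC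
  have hdom : ∀ x : GridPoint I m, ∃ i ∈ C, ∀ s : GridPoint I m, Sum.inl s ∈ S → x.1 i ≤ s.1 i := by
    intro x
    obtain ⟨i, hi⟩ := hd (Sum.inl x)
    refine ⟨i, ?_, fun s hs => ?_⟩
    · simp only [hC, Finset.mem_filter, Finset.mem_univ, true_and]
      intro hiS
      have hr := isSlackRanking_gridRanking I m
      exact absurd (hr.injective i (le_antisymm (hi _ hiS) (hr.slack_le i _))) (by simp)
    · exact Int.ofNat_le.1 (Prod.Lex.monotone_fst _ _ (hi _ hs))
  have hcol : ∀ i ∈ C, ∃ s : GridPoint I m, Sum.inl s ∈ S ∧ c s = i := by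
    intro i hi
    have h : i ∈ S.image (Sum.elim c id) := hc ▸ Finset.mem_univ i
    obtain ⟨s | j, hs, rfl⟩ := Finset.mem_image.1 h
    · exact ⟨s, hs, rfl⟩
    · exact absurd hs (by simpa [hC] using hi)
  obtain ⟨q, hq⟩ : ∃ q : GridPoint I m, Sum.inl q ∈ S := by
    obtain ⟨i, hi, -⟩ := hdom (Classical.arbitrary _)
    exact (hcol i hi).imp fun _ h => h.1
  -- The coordinatewise minimum of the grid points in `S`.
  have hmin : ∀ i, ∃ s : GridPoint I m, Sum.inl s ∈ S ∧
      ∀ t : GridPoint I m, Sum.inl t ∈ S → s.1 i ≤ t.1 i := by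
    intro i
    obtain ⟨s, hs, hs'⟩ :=
      (Finset.univ.filter fun s : GridPoint I m => Sum.inl s ∈ S).exists_min_image (fun s => s.1 i) ⟨q, by simpa using hq⟩
    exact ⟨s, by simpa using hs, fun t ht => hs' t (by simpa using ht)⟩
  choose μ hμS hμ using hmin
  -- Otherwise some grid point would exceed all these minima at once.
  have hlarge : m ≤ ∑ i ∈ C, (μ i).1 i + Fintype.card I := by
    by_contra! hlt
    obtain ⟨x, hx⟩ := GridPoint.exists_ge (m := m) (fun i => if i ∈ C then (μ i).1 i + 1 else 0) (by
      rw [← Finset.sum_filter, Finset.filter_mem_eq_inter, Finset.univ_inter,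
        Finset.sum_add_distrib]
      have := Finset.card_le_univ C
      simp only [Finset.sum_const, smul_eq_mul, mul_one]
      omega)
    obtain ⟨i, hi, h⟩ := hdom x
    have h1 := hx i
    have h2 := h _ (hμS i)
    simp only [if_pos hi] at h1
    omega
  have hclose : ∀ s : GridPoint I m, Sum.inl s ∈ S → ∀ i,
      s.1 i ≤ (if i ∈ C then (μ i).1 i else 0) + Fintype.card I := by
    intro s hs i
    have h1 : ∑ j, (if j ∈ C then (μ j).1 j else 0) = ∑ j ∈ C, (μ j).1 j := by
      rw [← Finset.sum_filter, Finset.filter_mem_eq_inter, Finset.univ_inter]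
    have h2 : ∀ j, (if j ∈ C then (μ j).1 j else 0) ≤ s.1 j := fun j => by
      split_ifs
      · exact hμ j s hs
      · exact Nat.zero_le _
    have h3 := s.sum_eq
    rw [← Finset.add_sum_erase _ _ (Finset.mem_univ i)] at h1 h3
    have h4 := Finset.sum_le_sum fun j (_ : j ∈ Finset.univ.erase i) => h2 j
    omega
  refine ⟨q, fun i => ?_⟩
  by_cases hi : i ∈ C
  · right
    obtain ⟨s, hs, hsi⟩ := hcol i hi
    have hbound : ∀ s t : GridPoint I m, Sum.inl s ∈ S → Sum.inl t ∈ S → ∀ l,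
        s.1 l ≤ t.1 l + Fintype.card I := fun s t hs ht l => by
      have h1 := hclose s hs l
      have h2 := hμ l t ht
      split_ifs at h1 <;> omega
    exact ⟨s, hsi, fun l => ⟨hbound q s hq hs l, hbound s q hs hq l⟩⟩
  · left
    simpa [hi] using hclose q hq i

open Filter Topology in
theorem brouwer_stdSimplex_of_nontrivial {I : Type*} [Fintype I] [Nontrivial I]
    {f : (I → ℝ) → I → ℝ} (hf : ContinuousOn f (stdSimplex ℝ I))
    (hmaps : Set.MapsTo f (stdSimplex ℝ I) (stdSimplex ℝ I)) :
    ∃ x ∈ stdSimplex ℝ I, f x = x := by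
  classical
  set n : ℝ := ((Fintype.card I : ℕ) : ℝ) with hn
  have happrox : ∀ m : ℕ, ∃ q ∈ stdSimplex ℝ I, ∀ i, q i ≤ n / (m + 1) ∨
      ∃ s ∈ stdSimplex ℝ I, s i ≤ f s i ∧ dist s q ≤ n / (m + 1) := by
    intro m
    have hpos : (0 : ℝ) < m + 1 := by positivity
    let p : GridPoint I (m + 1) → I → ℝ := fun x i => x.1 i / (m + 1)
    have hp : ∀ x, p x ∈ stdSimplex ℝ I := fun x => by
      refine ⟨fun i => by positivity, ?_⟩
      rw [← Finset.sum_div, div_eq_one_iff_eq hpos.ne']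
      exact_mod_cast x.sum_eq
    have hcol : ∀ x, ∃ i, p x i ≤ f (p x) i := fun x => by
      obtain ⟨i, -, hi⟩ := Finset.exists_le_of_sum_le (s := Finset.univ) (f := p x)
        (g := f (p x)) Finset.univ_nonempty (by rw [(hp x).2, (hmaps (hp x)).2])
      exact ⟨i, hi⟩
    choose c hc using hcol
    obtain ⟨q, hq⟩ := exists_gridPoint_of_coloring (m + 1) c
    refine ⟨p q, hp q, fun i => (hq i).imp (fun h => ?_) ?_⟩
    · exact div_le_div_of_nonneg_right (by rw [hn]; exact_mod_cast h) hpos.le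
    · rintro ⟨s, rfl, hs⟩
      refine ⟨p s, hp s, hc s, (dist_pi_le_iff (by positivity)).2 fun l => ?_⟩
      rw [Real.dist_eq, ← sub_div, abs_div, abs_of_pos hpos]
      refine div_le_div_of_nonneg_right (abs_le.2 ?_) hpos.le
      obtain ⟨h1, h2⟩ := hs l
      have h1' : (q.1 l : ℝ) ≤ s.1 l + n := by rw [hn]; exact_mod_cast h1
      have h2' : (s.1 l : ℝ) ≤ q.1 l + n := by rw [hn]; exact_mod_cast h2
      constructor <;> linarith
  choose q hqmem hq using happrox
  obtain ⟨x, hx, φ, hφ, hlim⟩ := (isCompact_stdSimplex ℝ I).tendsto_subseq hqmem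
  have hzero : Tendsto (fun k => n / ((φ k : ℝ) + 1)) atTop (𝓝 0) :=
    (tendsto_const_div_atTop_nhds_zero_nat n).comp (tendsto_add_atTop_nat 1 |>.comp hφ.tendsto_atTop)
      |>.congr fun k => by simp
  have hle : ∀ i, x i ≤ f x i := by
    intro i
    by_contra! hlt
    have hxi : 0 < x i := ((hmaps hx).1 i).trans_lt hlt
    have hcont : ContinuousWithinAt (fun s => f s i - s i) (stdSimplex ℝ I) x :=
      ((continuous_apply i).comp_continuousOn hf x hx).sub (continuous_apply i).continuousWithinAt
    obtain ⟨δ, hδ, hball⟩ := Metric.mem_nhdsWithin_iff.1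
      (hcont.eventually_lt_const (sub_neg.2 hlt))
    have hlimi : Tendsto (fun k => q (φ k) i) atTop (𝓝 (x i)) :=
      ((continuous_apply i).tendsto x).comp hlim
    obtain ⟨k, h1, h2, h3⟩ := ((hzero.eventually_lt hlimi hxi).and
      ((hzero.eventually_lt_const (half_pos hδ)).and
        (Metric.tendsto_nhds.1 hlim (δ / 2) (half_pos hδ)))).exists
    rcases hq (φ k) i with h | ⟨s, hs, hsi, hd⟩
    · exact h.not_gt h1
    · have : dist s x < δ := by
        have := dist_triangle s (q (φ k)) x
        simp only [Function.comp_apply] at h3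
        linarith
      have hneg : f s i - s i < 0 := hball ⟨Metric.mem_ball.2 this, hs⟩
      linarith
  refine ⟨x, hx, funext fun i => ?_⟩
  have hsum : ∑ i, x i = ∑ i, f x i := by rw [hx.2, (hmaps hx).2]
  exact ((Finset.sum_eq_sum_iff_of_le fun i _ => hle i).1 hsum i (Finset.mem_univ i)).symm

/-- **Brouwer's fixed point theorem** for the standard simplex. -/
theorem brouwer_stdSimplex {I : Type*} [Fintype I] [Nonempty I]
    {f : (I → ℝ) → I → ℝ} (hf : ContinuousOn f (stdSimplex ℝ I))
    (hmaps : Set.MapsTo f (stdSimplex ℝ I) (stdSimplex ℝ I)) :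
    ∃ x ∈ stdSimplex ℝ I, f x = x := by
  rcases subsingleton_or_nontrivial I with h | h
  · obtain ⟨i₀⟩ := ‹Nonempty I›
    have hone : (fun _ => 1 : I → ℝ) ∈ stdSimplex ℝ I :=
      ⟨fun _ => zero_le_one, by rw [Fintype.sum_subsingleton _ i₀]⟩
    refine ⟨_, hone, funext fun i => ?_⟩
    have := (hmaps hone).2
    rwa [Fintype.sum_subsingleton _ i] at this
  · exact brouwer_stdSimplex_of_nontrivial hf hmaps

end Brouwer

/-! ### Ky Fan's minimax inequality -/

section KyFan

variable {E : Type*} [AddCommGroup E] [Module ℝ E] [TopologicalSpace E] [IsTopologicalAddGroup E]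
  [ContinuousSMul ℝ E]

/-- Ky Fan's inequality for finitely many `y`. The fixed points of
`w ↦ (w i + max 0 (Ψ x(w) (y i))) / (1 + ∑ k, max 0 (Ψ x(w) (y k)))`, where `x(w) = ∑ i, w i • y i`,
are the weights of a solution: otherwise the support of `w` would be
the set of those `i` with `Ψ x(w) (y i) > 0`, and concavity would give `Ψ x(w) x(w) > 0`. -/
theorem exists_forall_le_zero_of_fintype {K : Set E} (hconv : Convex ℝ K) {Ψ : E → E → ℝ}
    (hcont : ∀ y ∈ K, ContinuousOn (fun x => Ψ x y) K) (hconc : ∀ x ∈ K, ConcaveOn ℝ K (Ψ x))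
    (hdiag : ∀ x ∈ K, Ψ x x ≤ 0) {I : Type*} [Fintype I] [Nonempty I] (y : I → E)
    (hy : ∀ i, y i ∈ K) : ∃ x ∈ K, ∀ i, Ψ x (y i) ≤ 0 := by
  let x : (I → ℝ) → E := fun w => ∑ i, w i • y i
  have hxcont : Continuous x := by fun_prop
  have hxmem : Set.MapsTo x (stdSimplex ℝ I) K := fun w hw =>
    hconv.sum_mem (fun i _ => hw.1 i) hw.2 fun i _ => hy i
  let g : (I → ℝ) → I → ℝ := fun w i => max 0 (Ψ (x w) (y i))
  have hg0 : ∀ w i, 0 ≤ g w i := fun w i => le_max_left _ _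
  have hg : ∀ i, ContinuousOn (fun w => g w i) (stdSimplex ℝ I) := fun i =>
    continuousOn_const.sup ((hcont _ (hy i)).comp hxcont.continuousOn hxmem)
  have hpos : ∀ w, 0 < 1 + ∑ k, g w k := fun w =>
    add_pos_of_pos_of_nonneg one_pos (Finset.sum_nonneg fun k _ => hg0 w k)
  obtain ⟨w, hw, hfix⟩ := brouwer_stdSimplex (I := I)
    (f := fun w i => (w i + g w i) / (1 + ∑ k, g w k))
    (continuousOn_pi.2 fun i => ((continuous_apply i).continuousOn.add (hg i)).div
      (continuousOn_const.add (continuousOn_finsetSum _ fun k _ => hg k)) fun w _ => (hpos w).ne')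
    (fun w hw => ⟨fun i => div_nonneg (add_nonneg (hw.1 i) (hg0 w i)) (hpos w).le, by
      rw [← Finset.sum_div, Finset.sum_add_distrib, hw.2, div_self (hpos w).ne']⟩)
  have hgw : ∀ i, g w i = w i * ∑ k, g w k := fun i => by
    have := congrFun hfix i
    simp only [div_eq_iff (hpos w).ne'] at this
    linarith
  refine ⟨x w, hxmem hw, fun i => ?_⟩
  by_contra! hi
  have hsum : 0 < ∑ k, g w k := Finset.sum_pos' (fun k _ => hg0 w k)
    ⟨i, Finset.mem_univ i, lt_max_of_lt_right hi⟩
  have hterm : ∀ k, 0 ≤ w k • Ψ (x w) (y k) := fun k => by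
    rcases (hw.1 k).eq_or_lt with h | h
    · simp [← h]
    · have : 0 < g w k := by
        rw [hgw]
        exact mul_pos h hsum
      exact smul_nonneg h.le ((lt_max_iff.1 this).resolve_left (lt_irrefl 0)).le
  have hwi : 0 < w i := pos_of_mul_pos_left (by
    rw [← hgw]
    exact lt_max_of_lt_right hi) hsum.le
  have h1 : 0 < ∑ k, w k • Ψ (x w) (y k) := Finset.sum_pos' (fun k _ => hterm k)
    ⟨i, Finset.mem_univ i, smul_pos hwi hi⟩
  have h2 := (hconc _ (hxmem hw)).le_map_sum (t := Finset.univ) (fun k _ => hw.1 k) hw.2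
    fun k _ => hy k
  exact (h1.trans_le h2).not_ge (hdiag _ (hxmem hw))

/-- **Ky Fan's minimax inequality**. -/
theorem exists_forall_le_zero [T2Space E] {K : Set E} (hcomp : IsCompact K) (hconv : Convex ℝ K)
    (hne : K.Nonempty) {Ψ : E → E → ℝ}
    (hcont : ∀ y ∈ K, ContinuousOn (fun x => Ψ x y) K) (hconc : ∀ x ∈ K, ConcaveOn ℝ K (Ψ x))
    (hdiag : ∀ x ∈ K, Ψ x x ≤ 0) : ∃ x ∈ K, ∀ y ∈ K, Ψ x y ≤ 0 := by
  obtain ⟨x, hx, hx'⟩ := hcomp.inter_iInter_nonempty (fun y : K => K ∩ {x | Ψ x y ≤ 0})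
    (fun y => (hcont y y.2).preimage_isClosed_of_isClosed hcomp.isClosed isClosed_Iic) fun u => by
      rcases u.eq_empty_or_nonempty with rfl | hu
      · simpa using hne
      · have := hu.to_subtype
        obtain ⟨x, hx, h⟩ := exists_forall_le_zero_of_fintype hconv hcont hconc hdiag
          (fun i : u => (i.1 : E)) fun i => i.1.2
        exact ⟨x, hx, Set.mem_iInter₂.2 fun y hy => ⟨hx, h ⟨y, hy⟩⟩⟩
  exact ⟨x, hx, fun y hy => (Set.mem_iInter.1 hx' ⟨y, hy⟩).2⟩

end KyFan

namespace QuantumNash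

/-! ### The set of channels -/

section ChannelSet

open scoped MatrixOrder Matrix.Norms.L2Operator CStarAlgebra

/-- Coefficients of linear maps `T` on `Op n`: the entry `v a b i j` stands for
`⟨i| T(|a⟩⟨b|) |j⟩`. -/
abbrev Coeff (n : ℕ) : Type := Fin n → Fin n → Fin n → Fin n → ℂ

/-- The linear map on `Op n` with given coefficients. -/
def Coeff.toLin {n : ℕ} (v : Coeff n) : Op n →ₗ[ℂ] Op n where
  toFun X := Matrix.of fun i j => ∑ a, ∑ b, X a b * v a b i j
  map_add' X Y := by
    ext i j
    simp [add_mul, Finset.sum_add_distrib]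
  map_smul' c X := by
    ext i j
    simp [mul_assoc, Finset.mul_sum]

theorem Coeff.toLin_apply {n : ℕ} (v : Coeff n) (X : Op n) (i j : Fin n) :
    v.toLin X i j = ∑ a, ∑ b, X a b * v a b i j := rfl

theorem Coeff.toLin_single {n : ℕ} (v : Coeff n) (a b i j : Fin n) :
    v.toLin (Matrix.single a b 1) i j = v a b i j := by
  simp [Coeff.toLin_apply, Matrix.single_apply, ite_and]

theorem Coeff.toLin_add {n : ℕ} (v w : Coeff n) : (v + w).toLin = v.toLin + w.toLin := by
  ext X i j
  simp [Coeff.toLin_apply, mul_add, Finset.sum_add_distrib]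

theorem Coeff.toLin_smul {n : ℕ} (c : ℝ) (v : Coeff n) : (c • v).toLin = (c : ℂ) • v.toLin := by
  ext X i j
  simp [Coeff.toLin_apply, Finset.mul_sum, mul_left_comm]

theorem Coeff.exists_toLin_eq {n : ℕ} (T : Op n →ₗ[ℂ] Op n) : ∃ v : Coeff n, v.toLin = T := by
  refine ⟨fun a b i j => T (Matrix.single a b 1) i j, ?_⟩
  refine Matrix.ext_linearMap ℂ fun a b => LinearMap.ext_ring ?_
  ext i j
  exact Coeff.toLin_single _ a b i j

/-- The coefficients of the channels on `ℂⁿ`. -/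
def channelSet (n : ℕ) : Set (Coeff n) := {v | ∃ Φ : Channel n, Φ.toLin = v.toLin}

theorem mem_channelSet_iff {n : ℕ} (v : Coeff n) :
    v ∈ channelSet n ↔
      (∀ (k : ℕ) (M : CStarMatrix (Fin k) (Fin k) (Op n)), 0 ≤ M → 0 ≤ M.map v.toLin) ∧
        ∀ X : Op n, (v.toLin X).trace = X.trace := by
  constructor
  · rintro ⟨⟨Φ, hΦ⟩, h⟩
    rw [← h]
    exact ⟨Φ.map_cstarMatrix_nonneg', hΦ⟩
  · rintro ⟨h1, h2⟩
    exact ⟨⟨⟨v.toLin, h1⟩, h2⟩, rfl⟩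

theorem convex_channelSet (n : ℕ) : Convex ℝ (channelSet n) := by
  intro v hv w hw s t hs ht hst
  rw [mem_channelSet_iff] at hv hw ⊢
  constructor
  · intro k M hM
    have : M.map (s • v + t • w).toLin = s • M.map v.toLin + t • M.map w.toLin := by
      ext i j : 2
      simp only [CStarMatrix.map_apply, CStarMatrix.add_apply, CStarMatrix.smul_apply,
        Coeff.toLin_add, Coeff.toLin_smul, LinearMap.add_apply, LinearMap.smul_apply,
        Complex.coe_smul]
    rw [this]
    exact add_nonneg (smul_nonneg hs (hv.1 k M hM)) (smul_nonneg ht (hw.1 k M hM))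
  · intro X
    simp only [Coeff.toLin_add, Coeff.toLin_smul, LinearMap.add_apply, LinearMap.smul_apply,
      Matrix.trace_add, Matrix.trace_smul, hv.2, hw.2, ← add_smul]
    rw [← Complex.ofReal_add, hst, Complex.ofReal_one, one_smul]

theorem channelSet_nonempty (n : ℕ) : (channelSet n).Nonempty := by
  obtain ⟨v, hv⟩ := Coeff.exists_toLin_eq (LinearMap.id : Op n →ₗ[ℂ] Op n)
  refine ⟨v, (mem_channelSet_iff v).2 ⟨fun k M hM => ?_, fun X => ?_⟩⟩
  · rw [hv]
    exact hM
  · rw [hv, LinearMap.id_apply]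

theorem isClosed_channelSet (n : ℕ) : IsClosed (channelSet n) := by
  have : channelSet n = (⋂ (k : ℕ) (M : CStarMatrix (Fin k) (Fin k) (Op n)) (_ : 0 ≤ M),
      {v : Coeff n | 0 ≤ M.map v.toLin}) ∩ ⋂ X : Op n, {v | (v.toLin X).trace = X.trace} := by
    ext v
    simp [mem_channelSet_iff]
  rw [this]
  have hcont : ∀ X : Op n, Continuous fun v : Coeff n => v.toLin X := fun X =>
    continuous_matrix fun i j => by
      simp only [Coeff.toLin_apply]
      fun_prop
  refine IsClosed.inter
    (isClosed_iInter fun k => isClosed_iInter fun M => isClosed_iInter fun _ => ?_)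
    (isClosed_iInter fun X => isClosed_eq (hcont X).matrix_trace continuous_const)
  exact (CStarAlgebra.isClosed_nonneg (A := CStarMatrix (Fin k) (Fin k) (Op n))).preimage
    (continuous_pi fun i => continuous_pi fun j => hcont (M i j))

theorem norm_apply_le_re_trace {n : ℕ} {X : Op n} (hX : 0 ≤ X) (i j : Fin n) :
    ‖X i j‖ ≤ X.trace.re := by
  obtain ⟨Y, rfl⟩ := CStarAlgebra.nonneg_iff_eq_star_mul_self.1 hX
  have htr : (star Y * Y).trace.re = ∑ k, ∑ l, ‖Y k l‖ ^ 2 := by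
    rw [Finset.sum_comm]
    simp [Matrix.trace, Matrix.mul_apply, Matrix.star_apply, Complex.re_sum, Complex.mul_re,
      Complex.sq_norm, Complex.normSq_apply]
  rw [htr, Matrix.mul_apply]
  refine (norm_sum_le _ _).trans (Finset.sum_le_sum fun k _ => ?_)
  have h : ∀ l, ‖Y k l‖ ^ 2 ≤ ∑ l, ‖Y k l‖ ^ 2 := fun l =>
    Finset.single_le_sum (f := fun l => ‖Y k l‖ ^ 2) (fun l _ => by positivity) (Finset.mem_univ l)
  rw [Matrix.star_apply, norm_mul, norm_star]
  nlinarith [h i, h j, two_mul_le_add_sq ‖Y k i‖ ‖Y k j‖]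

/-- Channels are uniformly bounded: on a positive operator the trace controls all entries, and
positive operators span `Op n`. -/
theorem exists_norm_channel_apply_le {n : ℕ} (X : Op n) :
    ∃ C : ℝ, ∀ Φ : Channel n, ∀ i j, ‖Φ.toLin X i j‖ ≤ C := by
  have hX : X ∈ Submodule.span ℂ {A : Op n | 0 ≤ A} := by
    rw [CStarAlgebra.span_nonneg]
    trivial
  induction hX using Submodule.span_induction with
  | mem A hA =>
    refine ⟨A.trace.re, fun Φ i j => ?_⟩
    have hpos : 0 ≤ Φ.1 A := map_nonneg Φ.1 hA
    have h := norm_apply_le_re_trace hpos i j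
    rwa [Φ.2 A] at h
  | zero => exact ⟨0, fun Φ i j => by simp⟩
  | add A B _ _ hA hB =>
    obtain ⟨C, hC⟩ := hA
    obtain ⟨D, hD⟩ := hB
    exact ⟨C + D, fun Φ i j => by
      rw [map_add]
      exact (norm_add_le _ _).trans (add_le_add (hC Φ i j) (hD Φ i j))⟩
  | smul c A _ hA =>
    obtain ⟨C, hC⟩ := hA
    exact ⟨‖c‖ * C, fun Φ i j => by
      rw [map_smul, Matrix.smul_apply, norm_smul]
      exact mul_le_mul_of_nonneg_left (hC Φ i j) (norm_nonneg c)⟩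

theorem isCompact_channelSet (n : ℕ) : IsCompact (channelSet n) := by
  choose C hC using fun a b : Fin n => exists_norm_channel_apply_le (Matrix.single a b (1 : ℂ))
  refine (isCompact_univ_pi fun a => isCompact_univ_pi fun b => isCompact_univ_pi fun _ =>
    isCompact_univ_pi fun _ => isCompact_closedBall (0 : ℂ) (C a b)).of_isClosed_subset
      (isClosed_channelSet n) ?_
  rintro v ⟨Φ, hΦ⟩
  simp only [Set.mem_pi, Set.mem_univ, true_imp_iff, mem_closedBall_zero_iff]
  intro a b i j
  rw [← Coeff.toLin_single v, ← hΦ]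
  exact hC a b Φ i j

end ChannelSet

end QuantumNash

namespace QuantumNash

/-! ### Payoffs as functions of the coefficients of the strategies -/

section Payoff

variable {N : ℕ} {d : Fin N → ℕ}

theorem tensorMap_coeff_apply (x : ∀ j, Coeff (d j)) (X : TOp d) (k l : ∀ j, Fin (d j)) :
    tensorMap (fun j => (x j).toLin) X k l =
      ∑ a, ∑ b, X a b * ∏ j, x j (a j) (b j) (k j) (l j) := by
  simp [tensorMap_apply, Matrix.sum_apply, tensorOp, Coeff.toLin_single]

theorem continuous_tensorMap_coeff (X : TOp d) :
    Continuous fun x : ∀ j, Coeff (d j) => tensorMap (fun j => (x j).toLin) X :=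
  continuous_matrix fun k l => by
    simp only [tensorMap_coeff_apply]
    fun_prop

theorem tensorMap_coeff_update (x : ∀ j, Coeff (d j)) (j : Fin N) (v w : Coeff (d j)) (s t : ℝ)
    (X : TOp d) :
    tensorMap (fun i => (Function.update x j (s • v + t • w) i).toLin) X =
      s • tensorMap (fun i => (Function.update x j v i).toLin) X +
        t • tensorMap (fun i => (Function.update x j w i).toLin) X := by
  ext k l
  have hprod : ∀ (u : Coeff (d j)) (a b : ∀ i, Fin (d i)),
      ∏ i, Function.update x j u i (a i) (b i) (k i) (l i) =
        u (a j) (b j) (k j) (l j) * ∏ i ∈ Finset.univ.erase j, x i (a i) (b i) (k i) (l i) := by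
    intro u a b
    rw [← Finset.mul_prod_erase _ _ (Finset.mem_univ j), Function.update_self]
    refine congrArg _ (Finset.prod_congr rfl fun i hi => ?_)
    rw [Function.update_of_ne (Finset.ne_of_mem_erase hi)]
  simp only [tensorMap_coeff_apply, Matrix.add_apply, Matrix.smul_apply, hprod, Finset.smul_sum,
    ← Finset.sum_add_distrib]
  refine Finset.sum_congr rfl fun a _ => Finset.sum_congr rfl fun b _ => ?_
  simp only [Pi.add_apply, Pi.smul_apply, Complex.real_smul]
  ring

/-- The payoff of a player is a linear function of the final state. The payoff series need not
converge on all operators, but it does on a subspace containing all final states, and a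
linear functional on a subspace extends to the whole space. -/
theorem QuantumGame.exists_payoff_eq {Ω : Type*} [Countable Ω] (G : QuantumGame d Ω)
    (hG : G.PayoffsConverge) (j : Fin N) :
    ∃ L : TOp d →ₗ[ℝ] ℝ, ∀ s : ∀ j, Channel (d j), G.fullGame.payoff j s = L (G.finalState s) := by
  let D : Submodule ℝ (TOp d) :=
    { carrier := {X | Summable fun ω => G.outcomePayoff j ω * (G.povm ω * X).trace.re}
      add_mem' := fun {X Y} hX hY => by
        refine (hX.add hY).congr fun ω => ?_
        rw [Matrix.mul_add, Matrix.trace_add, Complex.add_re, mul_add]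
      zero_mem' := by simp [summable_zero]
      smul_mem' := fun c X hX => by
        refine (hX.mul_left c).congr fun ω => ?_
        rw [Matrix.mul_smul, Matrix.trace_smul, Complex.smul_re, smul_eq_mul]
        ring }
  let ℓ : D →ₗ[ℝ] ℝ :=
    { toFun := fun X => ∑' ω, G.outcomePayoff j ω * (G.povm ω * X.1).trace.re
      map_add' := fun X Y => by
        rw [← X.2.tsum_add Y.2]
        refine tsum_congr fun ω => ?_
        rw [Submodule.coe_add, Matrix.mul_add, Matrix.trace_add, Complex.add_re, mul_add]
      map_smul' := fun c X => by
        rw [RingHom.id_apply, smul_eq_mul, ← tsum_mul_left]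
        refine tsum_congr fun ω => ?_
        rw [Submodule.coe_smul, Matrix.mul_smul, Matrix.trace_smul, Complex.smul_re, smul_eq_mul]
        ring }
  obtain ⟨L, hL⟩ := ℓ.exists_extend
  exact ⟨L, fun s => (LinearMap.congr_fun hL ⟨G.finalState s, hG j s⟩).symm⟩

end Payoff

end QuantumNash

/-! ### Existence of a Nash equilibrium -/

theorem mainTheorem2 {N : ℕ} (d : Fin N → ℕ) (Ω : Type*) [Countable Ω]
    (G : QuantumNash.QuantumGame d Ω) (hG : G.PayoffsConverge) :
    ∃ s : ∀ j, QuantumNash.Channel (d j), G.fullGame.IsNashEquilibrium s := by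
  classical
  choose L hL using G.exists_payoff_eq hG
  let P : Fin N → (∀ j, QuantumNash.Coeff (d j)) → ℝ := fun j x =>
    L j (QuantumNash.tensorMap (fun i => (x i).toLin) G.state)
  have hP : ∀ j, Continuous (P j) := fun j =>
    (L j).continuous_of_finiteDimensional.comp (QuantumNash.continuous_tensorMap_coeff G.state)
  have hupdate : ∀ (x : ∀ j, QuantumNash.Coeff (d j)) (j) (v w : QuantumNash.Coeff (d j)) (s t : ℝ),
      P j (Function.update x j (s • v + t • w)) =
        s * P j (Function.update x j v) + t * P j (Function.update x j w) := by
    intro x j v w s t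
    simp only [P, QuantumNash.tensorMap_coeff_update, map_add, map_smul, smul_eq_mul]
  let K : Set (∀ j, QuantumNash.Coeff (d j)) :=
    Set.univ.pi fun j => QuantumNash.channelSet (d j)
  have hK : Convex ℝ K := convex_pi fun j _ => QuantumNash.convex_channelSet (d j)
  -- `Ψ x y` is the total gain of the players if each of them deviates alone from `x` to `y`.
  obtain ⟨x, hx, hxy⟩ := exists_forall_le_zero (K := K)
    (Ψ := fun x y => ∑ j, (P j (Function.update x j (y j)) - P j x))
    (isCompact_univ_pi fun j => QuantumNash.isCompact_channelSet (d j)) hK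
    (Set.univ_pi_nonempty_iff.2 fun j => QuantumNash.channelSet_nonempty (d j))
    (fun y _ => (continuous_finsetSum _ fun j _ => ((hP j).comp
      (continuous_id.update j continuous_const)).sub (hP j)).continuousOn)
    (fun x _ => ⟨hK, fun y _ z _ s t _ _ hst => by
      simp only [Pi.add_apply, Pi.smul_apply, hupdate, smul_eq_mul, Finset.mul_sum,
        ← Finset.sum_add_distrib]
      refine (Finset.sum_congr rfl fun j _ => ?_).le
      linear_combination (-P j x) * hst⟩)
    (fun x _ => by simp)
  choose s hs using fun j => hx j (Set.mem_univ j)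
  have hpayoff : ∀ (j) (s' : ∀ j, QuantumNash.Channel (d j)) (x' : ∀ j, QuantumNash.Coeff (d j)),
      (∀ i, (s' i).toLin = (x' i).toLin) → G.fullGame.payoff j s' = P j x' := by
    intro j s' x' h
    rw [hL, QuantumNash.QuantumGame.finalState, funext h]
  refine ⟨s, fun j (t : QuantumNash.Channel (d j)) => ?_⟩
  obtain ⟨w, hw⟩ := QuantumNash.Coeff.exists_toLin_eq t.toLin
  have hwK : Function.update x j w ∈ K := fun i _ => by
    by_cases hi : i = j
    · subst hi
      exact ⟨t, by rw [Function.update_self, hw]⟩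
    · rw [Function.update_of_ne hi]
      exact hx i (Set.mem_univ i)
  have hle := hxy _ hwK
  rw [Finset.sum_eq_single j (fun i _ hi => by simp [Function.update_of_ne hi]) (by simp),
    Function.update_self] at hle
  have h := hpayoff j (Function.update s j t) (Function.update x j w) fun i => by
    by_cases hi : i = j
    · subst hi
      simp [hw]
    · simp [Function.update_of_ne hi, hs]
  exact (h.trans_le (sub_nonpos.1 hle)).trans (hpayoff j s x hs).ge
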